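/- A one-counter system $\mathcal{O}$ consists of a finite set $Q$ of states, a set $T_{>0} \subseteq Q \times \{-1,0,1\} \times Q$ of non-zero transitions and a set $T_{=0} \subseteq Q \times \{0,1\} \times Q$ of zero tests. Its configurations are the pairs in $Q \times \mathbb{N}$ (where $0 \in \mathbb{N}$), and there is an edge $(p,c) \to (q,c+d)$ whenever either $c \ge 1$ and $(p,d,q) \in T_{>0}$, or $c = 0$ and $(p,d,q) \in T_{=0}$. A path is a finite, possibly empty, walk in the directed graph formed by these edges; vertices and edges may repeat, and its length is the number of edges counted with repetition. A configuration $\beta$ is reachable from $\alpha$ if $\alpha \to^* \beta$, where $\to^*$ is the reflexive transitive closure of $\to$. **Theorem.** Let $\mathcal{O}$ be a one-counter system with $n$ states. Suppose that the configuration $\beta = (p_\beta, 0)$ is reachable from the configuration $\alpha = (p_\alpha, 0)$ in $\mathcal{O}$. Then $\mathcal{O}$ has a path from $\alpha$ to $\beta$ of length at most $14 n^2$. -/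

import Mathlib

/-- A one-counter system with set of states `Q`: a set of non-zero transitions contained in
`Q × {-1, 0, 1} × Q` and a set of zero tests contained in `Q × {0, 1} × Q`. The effect of a
transition is stored as an integer. -/
structure OneCounterSystem (Q : Type*) where
  nonzeroTransitions : Set (Q × ℤ × Q)
  zeroTests : Set (Q × ℤ × Q)
  effect_nonzero : ∀ t ∈ nonzeroTransitions, t.2.1 ∈ ({-1, 0, 1} : Set ℤ)
  effect_zero : ∀ t ∈ zeroTests, t.2.1 ∈ ({0, 1} : Set ℤ)

namespace OneCounterSystem

variable {Q : Type*}

/-- `O.Fires t γ γ'`: the transition `t` of `O` can be fired in the configuration `γ`, with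
result `γ'`. A configuration is a pair of a state and a counter value. -/
def Fires (O : OneCounterSystem Q) (t : Q × ℤ × Q) (γ γ' : Q × ℕ) : Prop :=
  (t ∈ O.nonzeroTransitions ∧ 1 ≤ γ.2 ∨ t ∈ O.zeroTests ∧ γ.2 = 0) ∧
    γ.1 = t.1 ∧ γ'.1 = t.2.2 ∧ (γ'.2 : ℤ) = (γ.2 : ℤ) + t.2.1

/-- The edge relation on configurations. -/
def Step (O : OneCounterSystem Q) (γ γ' : Q × ℕ) : Prop :=
  ∃ t, O.Fires t γ γ'

/-- `O.Reachable α β`: the configuration `β` is reachable from `α`. -/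
def Reachable (O : OneCounterSystem Q) (α β : Q × ℕ) : Prop :=
  Relation.ReflTransGen O.Step α β

/-- `O.IsPath α ρ β`: the sequence `ρ = (γ₁, t₁) … (γₘ, tₘ)` is a path of `O` from `α` to `β`,
that is, `γ₁ = α`, firing `tᵢ` in `γᵢ` results in `γᵢ₊₁`, and firing `tₘ` in `γₘ` results in `β`.
The length of the path is the length `m` of the list; the empty path leads from `α` to `α`. -/
def IsPath (O : OneCounterSystem Q) (α : Q × ℕ) :
    List ((Q × ℕ) × (Q × ℤ × Q)) → Q × ℕ → Prop
  | [], β => α = β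
  | (γ, t) :: ρ, β => γ = α ∧ ∃ γ', O.Fires t γ γ' ∧ O.IsPath γ' ρ β

end OneCounterSystem

open Relation

/-! Configurations of height at most `5n` number `n(5n+1)`, and cutting out loops makes a path enter
each at most once. It remains to find a path with at most `7n²` steps ending above that height. An
excursion above `5n` climbs through more levels than there are states, so near the bottom it
contains a closed walk of positive effect. Its strongly connected component therefore contains a
positive cycle no longer than the component. One such cycle is fixed per component, so all chosen
lengths sum to at most `n`; the same is done in the reversed graph for descents. Every excursion
then becomes a `Jump`: pump a chosen cycle of effect `A`, follow a walk with integer counter,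
descend along a chosen cycle of effect `-B`. The middle walk only has to hit the right height modulo
`gcd A B`, since pumping corrects the rest and keeps the counter positive (`Jump.exists_traj`).
Because only congruences matter, prefixes and suffixes of middle walks can be recombined, even
across different excursions. A chain of jumps of minimal total weight admits no such shortcut
(`exists_clashFree`). Hence the jumps using a given up-cycle have at most `nA` middle vertices in
all, those using a given down-cycle at most `nB`, and at most `gcd A B` jumps use a given pair.
Summing costs over the cycles gives `7n²` (`ClashFree.sum_cost_le`). -/

namespace CounterWalk

/-! ### Walks in a directed graph and the removal of loops. -/

section Traj

variable {V W : Type*} {R : V → V → Prop}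

/-- `Traj R x l y`: the list `l` of vertices leads from `x` to `y` along `R`; the starting
vertex `x` is not recorded in `l`, so that `l.length` is the number of steps. -/
def Traj (R : V → V → Prop) : V → List V → V → Prop
  | x, [], y => x = y
  | x, z :: l, y => R x z ∧ Traj R z l y

theorem traj_append {x z : V} {l₁ l₂ : List V} :
    Traj R x (l₁ ++ l₂) z ↔ ∃ y, Traj R x l₁ y ∧ Traj R y l₂ z := by
  induction l₁ generalizing x with
  | nil => simp [Traj]
  | cons a l ih => simp [Traj, ih, and_assoc]

theorem Traj.append {x y z : V} {l₁ l₂ : List V} (h₁ : Traj R x l₁ y) (h₂ : Traj R y l₂ z) :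
    Traj R x (l₁ ++ l₂) z :=
  traj_append.2 ⟨y, h₁, h₂⟩

theorem traj_append_cons {x y z : V} {l₁ l₂ : List V} :
    Traj R x (l₁ ++ y :: l₂) z ↔ Traj R x (l₁ ++ [y]) y ∧ Traj R y l₂ z := by
  simp only [traj_append, Traj]
  constructor
  · rintro ⟨w, h₁, h₂, h₃⟩
    exact ⟨⟨w, h₁, h₂, trivial⟩, h₃⟩
  · rintro ⟨⟨w, h₁, h₂, -⟩, h₃⟩
    exact ⟨w, h₁, h₂, h₃⟩

theorem Traj.split {x y a : V} {l p q : List V} (h : Traj R x l y) (e : x :: l = p ++ a :: q) :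
    ∃ l₁, l₁.length = p.length ∧ Traj R x l₁ a ∧ Traj R a q y := by
  cases p with
  | nil =>
    simp only [List.nil_append, List.cons.injEq] at e
    obtain ⟨rfl, rfl⟩ := e
    exact ⟨[], rfl, rfl, h⟩
  | cons b p =>
    simp only [List.cons_append, List.cons.injEq] at e
    obtain ⟨rfl, rfl⟩ := e
    obtain ⟨h₁, h₂⟩ := traj_append_cons.1 h
    exact ⟨p ++ [a], by simp, h₁, h₂⟩

theorem Traj.map {R' : W → W → Prop} (f : V → W) (hf : ∀ x y, R x y → R' (f x) (f y)) {x y : V}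
    {l : List V} (h : Traj R x l y) : Traj R' (f x) (l.map f) (f y) := by
  induction l generalizing x with
  | nil => exact congrArg f h
  | cons a l ih => exact ⟨hf _ _ h.1, ih h.2⟩

theorem Traj.reverse {x y : V} {l : List V} (h : Traj R x l y) :
    ∃ l', l'.length = l.length ∧ Traj (Function.swap R) y l' x := by
  induction l generalizing x with
  | nil => exact ⟨[], rfl, (show x = y from h).symm⟩
  | cons a l ih =>
    obtain ⟨l', hl, h'⟩ := ih h.2
    exact ⟨l' ++ [x], by simp [hl], h'.append ⟨h.1, rfl⟩⟩

theorem Traj.reflTransGen {x y : V} {l : List V} (h : Traj R x l y) : ReflTransGen R x y := by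
  induction l generalizing x with
  | nil => exact (show x = y from h) ▸ ReflTransGen.refl
  | cons a l ih => exact ReflTransGen.head h.1 (ih h.2)

theorem exists_traj {x y : V} (h : ReflTransGen R x y) : ∃ l, Traj R x l y := by
  induction h using ReflTransGen.head_induction_on with
  | refl => exact ⟨[], rfl⟩
  | head h _ ih =>
    obtain ⟨l, hl⟩ := ih
    exact ⟨_ :: l, h, hl⟩

/-- The relation `R` restricted to the vertices satisfying `P`. -/
def Within (R : V → V → Prop) (P : V → Prop) (x y : V) : Prop :=
  R x y ∧ P x ∧ P y

theorem Traj.within {P : V → Prop} {x y : V} {l : List V} (h : Traj R x l y) (hx : P x)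
    (hl : ∀ z ∈ l, P z) : Traj (Within R P) x l y := by
  induction l generalizing x with
  | nil => exact h
  | cons a l ih =>
    have ha := hl a (by simp)
    exact ⟨⟨h.1, hx, ha⟩, ih h.2 ha fun z hz => hl z (by simp [hz])⟩

theorem reflTransGen_within_mono {P P' : V → Prop} (hP : ∀ x, P x → P' x) {x y : V}
    (h : ReflTransGen (Within R P) x y) : ReflTransGen (Within R P') x y :=
  ReflTransGen.mono (fun _ _ hab => ⟨hab.1, hP _ hab.2.1, hP _ hab.2.2⟩) _ _ h

theorem reflTransGen_of_within {P : V → Prop} {x y : V} (h : ReflTransGen (Within R P) x y) :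
    ReflTransGen R x y :=
  ReflTransGen.mono (fun _ _ hab => hab.1) _ _ h

theorem exists_split_of_not_nodup {l : List V} (h : ¬ l.Nodup) :
    ∃ a p q r, l = p ++ a :: q ++ a :: r := by
  induction l with
  | nil => simp at h
  | cons b l ih =>
    by_cases hb : b ∈ l
    · obtain ⟨q, r, rfl⟩ := List.append_of_mem hb
      exact ⟨b, [], q, r, by simp⟩
    · obtain ⟨a, p, q, r, rfl⟩ := ih fun hl => h (List.nodup_cons.2 ⟨hb, hl⟩)
      exact ⟨a, b :: p, q, r, by simp⟩

theorem exists_split_of_not_nodup_map {f : V → W} {l : List V} (h : ¬ (l.map f).Nodup) :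
    ∃ a b p q r, f a = f b ∧ l = p ++ a :: q ++ b :: r := by
  induction l with
  | nil => simp at h
  | cons b l ih =>
    by_cases hb : f b ∈ l.map f
    · obtain ⟨a, ha, hab⟩ := List.mem_map.1 hb
      obtain ⟨q, r, rfl⟩ := List.append_of_mem ha
      exact ⟨b, a, [], q, r, hab.symm, by simp⟩
    · obtain ⟨a, a', p, q, r, haa, rfl⟩ := ih fun hl => h (List.nodup_cons.2 ⟨hb, hl⟩)
      exact ⟨a, a', b :: p, q, r, haa, by simp⟩

open Classical in
/-- Shortcutting repeated vertices, every vertex of a finite set `F` is entered at most once. -/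
theorem Traj.exists_length_le {x y : V} {l : List V} (h : Traj R x l y) (F : Finset V) :
    ∃ l', Traj R x l' y ∧ l'.length ≤ F.card + l.countP (· ∉ F) := by
  induction hk : l.length using Nat.strong_induction_on generalizing l with
  | _ k ih =>
    by_cases hn : l.Nodup
    · refine ⟨l, h, ?_⟩
      have h₁ : l.length = l.countP (· ∈ F) + l.countP (· ∉ F) := by
        simpa using List.length_eq_countP_add_countP (p := (· ∈ F)) (l := l)
      have h₂ : l.countP (· ∈ F) ≤ F.card := by
        rw [List.countP_eq_length_filter, ← List.toFinset_card_of_nodup (hn.filter _)]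
        apply Finset.card_le_card
        intro a ha
        simpa using (List.mem_filter.1 (List.mem_toFinset.1 ha)).2
      omega
    · obtain ⟨a, p, q, r, rfl⟩ := exists_split_of_not_nodup hn
      have h₂ := (traj_append_cons.1 h).2
      rw [List.append_assoc, List.cons_append] at h
      have h₁ := (traj_append_cons.1 h).1
      obtain ⟨l', hl', hlen⟩ := ih (p ++ a :: r).length
        (by rw [← hk]; simp) (traj_append_cons.2 ⟨h₁, h₂⟩) rfl
      refine ⟨l', hl', hlen.trans (Nat.add_le_add_left ?_ _)⟩
      simp only [List.countP_append, List.countP_cons]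
      omega

end Traj

/-! ### Walks with an unbounded integer counter. -/

section Weighted

variable {Q : Type*} {T : Q → ℤ → Q → Prop}

/-- The steps between configurations with an unbounded integer counter. -/
def ZStep (T : Q → ℤ → Q → Prop) (x y : Q × ℤ) : Prop :=
  T x.1 (y.2 - x.2) y.1

/-- Translation of the counter. -/
def shift (c : ℤ) (x : Q × ℤ) : Q × ℤ :=
  (x.1, x.2 + c)

theorem ZStep.shift (c : ℤ) (x y : Q × ℤ) (h : ZStep T x y) :
    ZStep T (shift c x) (shift c y) := by
  simpa [ZStep, CounterWalk.shift] using h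

theorem reflTransGen_shift {u v : Q} {a b : ℤ} (h : ReflTransGen (ZStep T) (u, a) (v, b))
    (c : ℤ) : ReflTransGen (ZStep T) (u, a + c) (v, b + c) :=
  ReflTransGen.lift (shift c) (ZStep.shift c) _ _ h

/-- The reversed weighted graph. -/
def rev (T : Q → ℤ → Q → Prop) (u : Q) (w : ℤ) (v : Q) : Prop :=
  T v (-w) u

theorem zStep_rev {x y : Q × ℤ} : ZStep (rev T) x y ↔ ZStep T y x := by
  simp [ZStep, rev]

theorem Traj.abs_sub_le (hT : ∀ u w v, T u w v → |w| ≤ 1) {x y : Q × ℤ} {l : List (Q × ℤ)}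
    (h : Traj (ZStep T) x l y) : ∀ z ∈ l, |z.2 - x.2| ≤ l.length := by
  induction l generalizing x with
  | nil => simp
  | cons a l ih =>
    have h₁ := hT _ _ _ h.1
    intro z hz
    simp only [List.length_cons, Nat.cast_add, Nat.cast_one]
    rcases List.mem_cons.1 hz with rfl | hz
    · have : (0 : ℤ) ≤ l.length := by positivity
      linarith
    · have h₂ := ih h.2 z hz
      have h₃ := abs_add_le (z.2 - a.2) (a.2 - x.2)
      rw [sub_add_sub_cancel] at h₃
      linarith

/-- Here `m` is the depth of the walk below its start. Reaching that depth takes `m` steps, and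
climbing from it to the end takes `y.2 - x.2 + m`, so the length dominates both quantities. These
two bounds later limit the pumping on the two sides of a jump. -/
theorem Traj.exists_drop (hT : ∀ u w v, T u w v → |w| ≤ 1) {x y : Q × ℤ} {l : List (Q × ℤ)}
    (h : Traj (ZStep T) x l y) : ∃ m : ℤ, 0 ≤ m ∧ m ≤ l.length ∧ (∀ z ∈ l, x.2 - m ≤ z.2) ∧
      x.2 - m ≤ y.2 ∧ y.2 - x.2 + m ≤ l.length := by
  induction l generalizing x with
  | nil =>
    have : x = y := h
    subst this
    exact ⟨0, by simp⟩
  | cons a l ih =>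
    have h₁ := abs_le.1 (hT _ _ _ h.1)
    obtain ⟨m, h₀, hm, hl, hy, hd⟩ := ih h.2
    simp only [List.length_cons, Nat.cast_add, Nat.cast_one]
    refine ⟨max 0 (m + x.2 - a.2), by omega, by omega, ?_, by omega, by omega⟩
    intro z hz
    rcases List.mem_cons.1 hz with rfl | hz
    · omega
    · have := hl z hz
      omega

theorem Traj.iterate {u : Q} {e : ℤ} {l : List (Q × ℤ)} (h : Traj (ZStep T) (u, 0) l (u, e))
    (a : ℤ) (k : ℕ) :
    ∃ l', l'.length = k * l.length ∧ Traj (ZStep T) (u, a) l' (u, a + k * e) ∧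
      ∀ z ∈ l', ∃ i : ℕ, i < k ∧ ∃ y ∈ l, z.2 = a + i * e + y.2 := by
  induction k with
  | zero => exact ⟨[], by simp, by simp [Traj], by simp⟩
  | succ k ih =>
    obtain ⟨l', hlen, htr, hz⟩ := ih
    have h' := h.map (shift (a + k * e)) (ZStep.shift _)
    refine ⟨l' ++ l.map (shift (a + k * e)), ?_, ?_, ?_⟩
    · simp [hlen]; ring
    · refine htr.append ?_
      have e₁ : shift (a + k * e) (u, (0 : ℤ)) = (u, a + k * e) := by simp [shift]
      have e₂ : shift (a + k * e) (u, e) = (u, a + ((k + 1 : ℕ) : ℤ) * e) := by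
        simp [shift]; ring
      rwa [e₁, e₂] at h'
    · intro z hz'
      rcases List.mem_append.1 hz' with hz' | hz'
      · obtain ⟨i, hi, y, hy⟩ := hz z hz'
        exact ⟨i, by omega, y, hy⟩
      · obtain ⟨y, hy, rfl⟩ := List.mem_map.1 hz'
        exact ⟨k, by omega, y, hy, by simp [shift]; ring⟩

end Weighted


/-! ### Positive walks, first visits to levels, and climbing loops. -/

section Ramp

variable {Q : Type*} {T : Q → ℤ → Q → Prop}

/-- Reachability with heights between `1` and `b`. -/
def BandReach (T : Q → ℤ → Q → Prop) (b : ℤ) : Q × ℤ → Q × ℤ → Prop :=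
  ReflTransGen (Within (ZStep T) fun x => 1 ≤ x.2 ∧ x.2 ≤ b)

/-- Reachability through positive heights. -/
def PosReach (T : Q → ℤ → Q → Prop) : Q × ℤ → Q × ℤ → Prop :=
  ReflTransGen (Within (ZStep T) fun x => 1 ≤ x.2)

theorem BandReach.mono {b b' : ℤ} (hb : b ≤ b') {x y : Q × ℤ} (h : BandReach T b x y) :
    BandReach T b' x y :=
  reflTransGen_within_mono (fun _ hx => ⟨hx.1, hx.2.trans hb⟩) h

theorem BandReach.refl {b : ℤ} (x : Q × ℤ) : BandReach T b x x :=
  ReflTransGen.refl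

theorem BandReach.trans {b : ℤ} {x y z : Q × ℤ} (h : BandReach T b x y)
    (h' : BandReach T b y z) : BandReach T b x z :=
  ReflTransGen.trans h h'

theorem BandReach.zReach {b : ℤ} {x y : Q × ℤ} (h : BandReach T b x y) :
    ReflTransGen (ZStep T) x y :=
  reflTransGen_of_within h

theorem PosReach.zReach {x y : Q × ℤ} (h : PosReach T x y) : ReflTransGen (ZStep T) x y :=
  reflTransGen_of_within h

theorem BandReach.shift {b c : ℤ} (hc : 0 ≤ c) {u v : Q} {i j : ℤ}
    (h : BandReach T b (u, i) (v, j)) : BandReach T (b + c) (u, i + c) (v, j + c) :=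
  ReflTransGen.lift (CounterWalk.shift c) (fun x y hxy =>
    ⟨ZStep.shift c x y hxy.1, by simp only [CounterWalk.shift]; have := hxy.2; omega⟩) _ _ h

theorem Traj.bandReach {b : ℤ} {x y : Q × ℤ} {l : List (Q × ℤ)} (h : Traj (ZStep T) x l y)
    (hx : 1 ≤ x.2 ∧ x.2 ≤ b) (hl : ∀ z ∈ l, 1 ≤ z.2 ∧ z.2 ≤ b) : BandReach T b x y :=
  Traj.reflTransGen (Traj.within (P := fun x : Q × ℤ => 1 ≤ x.2 ∧ x.2 ≤ b) h hx hl)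

theorem posReach_rev {x y : Q × ℤ} (h : PosReach T x y) : PosReach (rev T) y x := by
  refine ReflTransGen.mono ?_ _ _ (ReflTransGen.swap _ _ h)
  exact fun a b hab => ⟨zStep_rev.2 hab.1, hab.2.2, hab.2.1⟩

theorem bandReach_of_rev {b : ℤ} {x y : Q × ℤ} (h : BandReach (rev T) b x y) :
    BandReach T b y x := by
  refine ReflTransGen.mono ?_ _ _ (ReflTransGen.swap _ _ h)
  exact fun a b hab => ⟨zStep_rev.1 hab.1, hab.2.2, hab.2.1⟩

theorem zReach_of_rev {x y : Q × ℤ} (h : ReflTransGen (ZStep (rev T)) x y) :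
    ReflTransGen (ZStep T) y x := by
  refine ReflTransGen.mono ?_ _ _ (ReflTransGen.swap _ _ h)
  exact fun a b hab => zStep_rev.1 hab

theorem rev_abs_le (hT : ∀ u w v, T u w v → |w| ≤ 1) : ∀ u w v, rev T u w v → |w| ≤ 1 :=
  fun u w v h => by simpa using hT v (-w) u h

/-- The first visit of a walk to the next level. -/
theorem exists_first_visit (hT : ∀ u w v, T u w v → |w| ≤ 1) {w : Q} {m k : ℤ} (hk : k < m)
    {x : Q × ℤ} (h : PosReach T x (w, m)) (hx : x.2 ≤ k) :
    ∃ y, BandReach T (k + 1) x (y, k + 1) ∧ PosReach T (y, k + 1) (w, m) := by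
  induction h using ReflTransGen.head_induction_on with
  | refl => exact absurd hx (not_le.2 hk)
  | head hac hcb ih =>
    rename_i a c
    have h₁ := abs_le.1 (hT _ _ _ hac.1)
    have h₂ : BandReach T (k + 1) a c :=
      ReflTransGen.single ⟨hac.1, ⟨hac.2.1, by omega⟩, ⟨hac.2.2, by omega⟩⟩
    by_cases hc : c.2 ≤ k
    · obtain ⟨y, hy₁, hy₂⟩ := ih hc
      exact ⟨y, h₂.trans hy₁, hy₂⟩
    · have hc' : c = (c.1, k + 1) := Prod.ext rfl (by simp only; omega)
      refine ⟨c.1, ?_, ?_⟩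
      · rwa [hc'] at h₂
      · rw [← hc']; exact hcb

/-- Iterates `exists_first_visit`: the stretch before the first visit to a level never exceeds that
level, which keeps the extracted loops low. Index `i` stands for level `i + 1`. -/
theorem exists_first_visits (hT : ∀ u w v, T u w v → |w| ≤ 1) {u w : Q} {m : ℤ}
    (h : PosReach T (u, 1) (w, m)) (N : ℕ) (hN : (N : ℤ) + 1 ≤ m) :
    ∃ f : ℕ → Q, ∀ i ≤ N, BandReach T (i + 1) (u, 1) (f i, i + 1) ∧
      PosReach T (f i, i + 1) (w, m) ∧
      ∀ j ≤ i, BandReach T (i + 1) (f j, j + 1) (f i, i + 1) := by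
  induction N with
  | zero =>
    refine ⟨fun _ => u, fun i hi => ?_⟩
    obtain rfl : i = 0 := by omega
    refine ⟨by simpa using BandReach.refl (T := T) (b := 1) (u, 1), by simpa using h,
      fun j hj => ?_⟩
    obtain rfl : j = 0 := by omega
    exact ReflTransGen.refl
  | succ N ih =>
    obtain ⟨f, hf⟩ := ih (by push_cast at hN; omega)
    obtain ⟨h₁, h₂, h₃⟩ := hf N le_rfl
    obtain ⟨y, hy₁, hy₂⟩ := exists_first_visit hT (k := (N : ℤ) + 1) (by push_cast at hN; omega)
      h₂ le_rfl
    have hfy : ∀ j ≤ N, Function.update f (N + 1) y j = f j := fun j hj =>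
      Function.update_of_ne (by omega) _ _
    refine ⟨Function.update f (N + 1) y, fun i hi => ?_⟩
    rcases Nat.lt_or_ge N i with hi' | hi'
    · obtain rfl : i = N + 1 := by omega
      rw [Function.update_self]
      push_cast
      refine ⟨(h₁.mono (by omega)).trans hy₁, hy₂, fun j hj => ?_⟩
      rcases Nat.lt_or_ge N j with hj' | hj'
      · obtain rfl : j = N + 1 := by omega
        rw [Function.update_self]
        push_cast
        exact ReflTransGen.refl
      · rw [hfy j hj']
        exact ((h₃ j hj').mono (by omega)).trans hy₁
    · rw [hfy i hi']
      obtain ⟨g₁, g₂, g₃⟩ := hf i hi'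
      refine ⟨g₁, g₂, fun j hj => ?_⟩
      rw [hfy j (hj.trans hi')]
      exact g₃ j hj

/-- A positive walk climbing higher than the number of states contains a closed walk of positive
effect at low height. -/
theorem exists_climbing_loop [Fintype Q] (hT : ∀ u w v, T u w v → |w| ≤ 1) {u w : Q} {m : ℤ}
    (h : PosReach T (u, 1) (w, m)) (hm : (Fintype.card Q : ℤ) + 1 ≤ m) :
    ∃ (s : Q) (i j : ℤ), 1 ≤ i ∧ i < j ∧ j ≤ Fintype.card Q + 1 ∧
      BandReach T (Fintype.card Q + 1) (u, 1) (s, i) ∧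
      BandReach T j (s, i) (s, j) ∧ PosReach T (s, i) (w, m) := by
  obtain ⟨f, hf⟩ := exists_first_visits hT h (Fintype.card Q) hm
  have key : ∀ a b : ℕ, a < b → b ≤ Fintype.card Q → f a = f b → ∃ (s : Q) (i j : ℤ), 1 ≤ i ∧
      i < j ∧ j ≤ Fintype.card Q + 1 ∧
      BandReach T (Fintype.card Q + 1) (u, 1) (s, i) ∧
      BandReach T j (s, i) (s, j) ∧ PosReach T (s, i) (w, m) := by
    intro a b hab hb heq
    refine ⟨f a, a + 1, b + 1, by omega, by omega, by omega,
      (hf a (by omega)).1.mono (by omega), ?_, (hf a (by omega)).2.1⟩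
    have := (hf b hb).2.2 a hab.le
    rwa [← heq] at this
  -- Two of the `n + 1` levels `1, …, n + 1` are first visited in the same state.
  obtain ⟨a, b, hne, heq⟩ := Fintype.exists_ne_map_eq_of_card_lt
    (fun i : Fin (Fintype.card Q + 1) => f i) (by simp)
  rcases lt_or_gt_of_ne (fun h => hne (Fin.ext h) : (a : ℕ) ≠ b) with hlt | hlt
  · exact key a b hlt (by omega) heq
  · exact key b a hlt (by omega) heq.symm

/-! ### Strongly connected components and short positive cycles. -/

/-- Reachability between states, regardless of the counter. -/
def SReach (T : Q → ℤ → Q → Prop) : Q → Q → Prop :=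
  ReflTransGen fun u v => ∃ w, T u w v

theorem sReach_of_zReach {x y : Q × ℤ} (h : ReflTransGen (ZStep T) x y) : SReach T x.1 y.1 :=
  ReflTransGen.lift Prod.fst (fun _ _ hxy => ⟨_, hxy⟩) _ _ h

theorem exists_traj_of_sReach [Fintype Q] {u v : Q} (h : SReach T u v) (a : ℤ) :
    ∃ l b, l.length ≤ Fintype.card Q ∧ Traj (ZStep T) (u, a) l (v, b) := by
  classical
  obtain ⟨l, hl⟩ := exists_traj h
  obtain ⟨l, hl, hlen⟩ := hl.exists_length_le Finset.univ
  have hlen' : l.length ≤ Fintype.card Q := by simpa using hlen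
  suffices ∀ (l : List Q) (u : Q) (a : ℤ), Traj (fun u v => ∃ w, T u w v) u l v →
      ∃ l' b, l'.length = l.length ∧ Traj (ZStep T) (u, a) l' (v, b) by
    obtain ⟨l', b, h₁, h₂⟩ := this l u a hl
    exact ⟨l', b, by omega, h₂⟩
  intro l
  induction l with
  | nil =>
    intro u a h
    exact ⟨[], a, rfl, by rw [show u = v from h]; rfl⟩
  | cons c l ih =>
    rintro u a ⟨⟨w, hw⟩, h⟩
    obtain ⟨l', b, h₁, h₂⟩ := ih c (a + w) h
    exact ⟨(c, a + w) :: l', b, by simp [h₁], by simpa [ZStep] using hw, h₂⟩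

/-- Mutual reachability. -/
def sccSetoid (T : Q → ℤ → Q → Prop) : Setoid Q where
  r u v := SReach T u v ∧ SReach T v u
  iseqv := ⟨fun _ => ⟨ReflTransGen.refl, ReflTransGen.refl⟩, fun h => ⟨h.2, h.1⟩,
    fun h h' => ⟨h.1.trans h'.1, h'.2.trans h.2⟩⟩

/-- A chosen representative of the strongly connected component of a state. -/
noncomputable def sccRep (T : Q → ℤ → Q → Prop) (u : Q) : Q :=
  (Quotient.mk (sccSetoid T) u).out

theorem sccRep_eq_iff {u v : Q} : sccRep T u = sccRep T v ↔ SReach T u v ∧ SReach T v u := by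
  rw [sccRep, sccRep, Quotient.out_inj]
  exact Quotient.eq (r := sccSetoid T)

open Classical in
/-- The number of states in the strongly connected component with representative `r`. -/
noncomputable def sccSize [Fintype Q] (T : Q → ℤ → Q → Prop) (r : Q) : ℕ :=
  (Finset.univ.filter fun u => sccRep T u = r).card

theorem sum_sccSize [Fintype Q] : ∑ r, sccSize T r = Fintype.card Q := by
  classical
  rw [← Finset.card_univ, Finset.card_eq_sum_card_fiberwise (f := sccRep T) (t := Finset.univ)
    (fun _ _ => Finset.mem_coe.2 (Finset.mem_univ _))]
  simp [sccSize]

/-- Take a shortest positive closed walk based in the component of `s`. A repeated state would split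
it into two shorter closed walks whose effects sum to a positive number, so one of them would be
positive. Hence its states are distinct, and all lie in the component. -/
theorem exists_simple_cycle [Fintype Q] {s : Q} {z : ℤ} (hz : 0 < z)
    (h : ReflTransGen (ZStep T) (s, 0) (s, z)) :
    ∃ (b : Q) (l : List (Q × ℤ)) (A : ℤ), 0 < A ∧ sccRep T b = sccRep T s ∧
      l.length ≤ sccSize T (sccRep T s) ∧ Traj (ZStep T) (b, 0) l (b, A) := by
  classical
  have hex : ∃ k, ∃ (b : Q) (l : List (Q × ℤ)) (A : ℤ), 0 < A ∧ sccRep T b = sccRep T s ∧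
      l.length = k ∧ Traj (ZStep T) (b, 0) l (b, A) := by
    obtain ⟨l, hl⟩ := exists_traj h
    exact ⟨_, s, l, z, hz, rfl, rfl, hl⟩
  obtain ⟨b, l, A, hA, hb, hlen, hl⟩ := Nat.find_spec hex
  have hmin := fun k hk => Nat.find_min hex (m := k) hk
  rw [← hlen] at hmin
  have hscc : ∀ x ∈ l, sccRep T x.1 = sccRep T b := by
    intro x hx
    obtain ⟨p, q, rfl⟩ := List.append_of_mem hx
    obtain ⟨h₁, h₂⟩ := traj_append_cons.1 hl
    exact sccRep_eq_iff.2 ⟨sReach_of_zReach h₂.reflTransGen, sReach_of_zReach h₁.reflTransGen⟩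
  have hnodup : (l.map Prod.fst).Nodup := by
    by_contra hn
    obtain ⟨x, y, p, q, r, hxy, rfl⟩ := exists_split_of_not_nodup_map hn
    have hy := traj_append_cons.1 hl
    rw [List.append_assoc, List.cons_append] at hy
    have hx := traj_append_cons.1 hy.1
    -- Either the inner loop is itself positive, or deleting it does not decrease the effect.
    rcases lt_or_ge 0 (y.2 - x.2) with hw | hw
    · refine hmin (q ++ [y]).length (by simp; omega) ⟨x.1, _, y.2 - x.2, hw,
        (hscc x (by simp)).trans hb, List.length_map (f := shift (-x.2)) (as := q ++ [y]), ?_⟩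
      have := hx.2.map (shift (-x.2)) (ZStep.shift _)
      have e₁ : shift (-x.2) x = (x.1, (0 : ℤ)) := by simp [shift]
      have e₂ : shift (-x.2) y = (x.1, y.2 - x.2) := by simp [shift, hxy, sub_eq_add_neg]
      rwa [e₁, e₂] at this
    · have h₂ := hy.2.map (shift (x.2 - y.2)) (ZStep.shift _)
      have e₁ : shift (x.2 - y.2) y = x := by simp [shift, ← hxy]
      rw [e₁] at h₂
      refine hmin (p ++ [x] ++ r).length (by simp) ⟨b, p ++ [x] ++ r.map (shift (x.2 - y.2)),
        A + (x.2 - y.2), by omega, hb, by simp, hx.1.append h₂⟩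
  refine ⟨b, l, A, hA, hb, ?_, hl⟩
  rw [← List.length_map (f := Prod.fst), ← List.toFinset_card_of_nodup hnodup]
  apply Finset.card_le_card
  intro u hu
  obtain ⟨x, hx, rfl⟩ := List.mem_map.1 (List.mem_toFinset.1 hu)
  simpa using (hscc x hx).trans hb

/-! ### Systems of chosen pumping cycles. -/

/-- Chosen positive cycles in pairwise disjoint sets of states, indexed by some of the states,
such that every sufficiently high positive walk can be made to enter one of them at a height of
about four times the number of states. -/
structure PumpSystem [Fintype Q] (T : Q → ℤ → Q → Prop) where
  good : Q → Prop
  size : Q → ℕ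
  len : Q → ℕ
  eff : Q → ℕ
  base : Q → Q
  sum_size : ∑ r, size r = Fintype.card Q
  eff_pos : ∀ r, good r → 0 < eff r
  len_le : ∀ r, good r → len r ≤ size r
  eff_le : ∀ r, good r → eff r ≤ len r
  cycle : ∀ r, good r →
    ∃ l, l.length = len r ∧ Traj (ZStep T) (base r, 0) l (base r, (eff r : ℤ))
  ramp : ∀ (u w : Q) (m : ℤ), (Fintype.card Q : ℤ) + 1 ≤ m → PosReach T (u, 1) (w, m) →
    ∃ r, good r ∧ ∃ h h₂ : ℤ, 4 * (Fintype.card Q : ℤ) - eff r < h ∧ h ≤ 4 * Fintype.card Q ∧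
      BandReach T (5 * Fintype.card Q) (u, 1) (base r, h) ∧ (eff r : ℤ) ∣ h₂ - h ∧
      ReflTransGen (ZStep T) (base r, h₂) (w, m)

theorem PumpSystem.len_le_card [Fintype Q] (P : PumpSystem T) {r : Q} (hr : P.good r) :
    P.len r ≤ Fintype.card Q := by
  rw [← P.sum_size]
  exact (P.len_le r hr).trans (Finset.single_le_sum (f := P.size) (fun _ _ => Nat.zero_le _)
    (Finset.mem_univ r))

theorem PumpSystem.cycle_iterate [Fintype Q] (P : PumpSystem T)
    (hT : ∀ u w v, T u w v → |w| ≤ 1) {r : Q} (hr : P.good r) (a : ℤ) (k : ℕ) :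
    ∃ l, l.length = k * P.len r ∧
      Traj (ZStep T) (P.base r, a) l (P.base r, a + k * P.eff r) ∧
      ∀ z ∈ l, a - Fintype.card Q ≤ z.2 ∧
        z.2 ≤ a + k * P.eff r - P.eff r + Fintype.card Q := by
  obtain ⟨l, hlen, hl⟩ := P.cycle r hr
  obtain ⟨l', h₁, h₂, h₃⟩ := hl.iterate a k
  refine ⟨l', by rw [h₁, hlen], h₂, fun z hz => ?_⟩
  obtain ⟨i, hi, y, hy, e⟩ := h₃ z hz
  have hy' := abs_le.1 (hl.abs_sub_le hT y hy)
  have hle := P.len_le_card hr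
  have h₄ : (0 : ℤ) ≤ i * P.eff r := by positivity
  have h₅ : ((i : ℤ) + 1) * P.eff r ≤ k * P.eff r :=
    mul_le_mul_of_nonneg_right (by omega) (by positivity)
  simp only [sub_zero] at hy'
  have hlen' : (l.length : ℤ) ≤ Fintype.card Q := by exact_mod_cast hlen ▸ hle
  constructor <;> linarith [hy'.1, hy'.2]

/-- A walk can be undone up to a multiple of any given modulus. -/
theorem exists_return {s b : Q} {i h k : ℤ} (hsb : ReflTransGen (ZStep T) (s, i) (b, h))
    (hbs : ReflTransGen (ZStep T) (b, 0) (s, k)) (A : ℕ) (hA : 0 < A) :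
    ∃ h₂, (A : ℤ) ∣ h₂ - h ∧ ReflTransGen (ZStep T) (b, h₂) (s, i) := by
  have loop : ∀ (t : ℕ) (a : ℤ), ReflTransGen (ZStep T) (s, a) (s, a + t * (h - i + k)) := by
    intro t
    induction t with
    | zero => intro a; simpa using ReflTransGen.refl
    | succ t ih =>
      intro a
      have h₁ := reflTransGen_shift hsb (a + t * (h - i + k) - i)
      have h₂ := reflTransGen_shift hbs (h + (a + t * (h - i + k) - i))
      rw [zero_add] at h₂
      have h₃ := h₁.trans h₂
      rw [add_sub_cancel] at h₃
      refine (ih a).trans ?_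
      convert h₃ using 2
      push_cast
      ring
  -- With `δ = h - i + k` the effect of the round trip at `s`, starting `A * δ` below `h` leaves
  -- room for the return to `s` and `A - 1` round trips, ending exactly at height `i`.
  have hb := reflTransGen_shift hbs (h - A * (h - i + k))
  rw [zero_add] at hb
  refine ⟨_, ?_, hb.trans ?_⟩
  · exact ⟨-(h - i + k), by ring⟩
  · convert loop (A - 1) (k + (h - A * (h - i + k))) using 2
    push_cast [Nat.cast_sub (show 1 ≤ A from hA)]
    ring

/-- For the ramp, the low loop lifts the walk so high that crossing its component to the chosen
cycle keeps the counter positive; the chosen cycle then lifts it to its last turn not above `4n`.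
One turn deviates by at most `n`, whence the ceiling `5n`. The original walk is resumed by returning
to the loop over `ℤ`, up to a multiple of the effect. -/
theorem nonempty_pumpSystem [Fintype Q] (hT : ∀ u w v, T u w v → |w| ≤ 1) :
    Nonempty (PumpSystem T) := by
  classical
  let good : Q → Prop := fun r => ∃ (b : Q) (l : List (Q × ℤ)) (A : ℕ), 0 < A ∧
    sccRep T b = r ∧ l.length ≤ sccSize T r ∧ Traj (ZStep T) (b, 0) l (b, (A : ℤ))
  have hgood : ∀ r, ∃ (b : Q) (l : List (Q × ℤ)) (A : ℕ), good r → 0 < A ∧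
      sccRep T b = r ∧ l.length ≤ sccSize T r ∧ Traj (ZStep T) (b, 0) l (b, (A : ℤ)) := by
    intro r
    by_cases hr : good r
    · obtain ⟨b, l, A, h⟩ := hr
      exact ⟨b, l, A, fun _ => h⟩
    · exact ⟨r, [], 0, fun h => absurd h hr⟩
  choose base cyc eff hspec using hgood
  have heff_le : ∀ r, good r → eff r ≤ (cyc r).length := by
    intro r hr
    obtain ⟨m, h₀, h₁, h₂, h₃, h₄⟩ := (hspec r hr).2.2.2.exists_drop hT
    simp only [sub_zero] at h₄
    omega
  have hcard : ∀ r, good r → (cyc r).length ≤ Fintype.card Q := by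
    intro r hr
    refine (hspec r hr).2.2.1.trans ?_
    rw [← sum_sccSize (T := T)]
    exact Finset.single_le_sum (f := sccSize T) (fun _ _ => Nat.zero_le _) (Finset.mem_univ r)
  refine ⟨⟨good, sccSize T, fun r => (cyc r).length, eff, base, sum_sccSize,
    fun r hr => (hspec r hr).1, fun r hr => (hspec r hr).2.2.1, heff_le,
    fun r hr => ⟨cyc r, rfl, (hspec r hr).2.2.2⟩, ?_⟩⟩
  intro u w m hm hreach
  obtain ⟨s, i, j, hi, hij, hj, hus, hss, hsw⟩ := exists_climbing_loop hT hreach hm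
  set n : ℤ := (Fintype.card Q : ℤ) with hn
  have hgs : good (sccRep T s) := by
    have h₁ := reflTransGen_shift hss.zReach (-i)
    rw [add_neg_cancel] at h₁
    obtain ⟨b, l, A, hA, hb, hlen, hl⟩ := exists_simple_cycle (by omega) h₁
    refine ⟨b, l, A.toNat, by omega, hb, hlen, ?_⟩
    rwa [Int.toNat_of_nonneg hA.le]
  obtain ⟨hA, hb, -, hcyc⟩ := hspec _ hgs
  have hlen := hcard _ hgs
  have heff := heff_le _ hgs
  set r := sccRep T s with hr
  refine ⟨r, hgs, ?_⟩
  set A : ℤ := (eff r : ℤ) with hAdef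
  have hA' : 0 < A := by omega
  -- pump the closed walk at `s` up to height `2n + 1`
  have hpump : ∀ k : ℕ, i + k * (j - i) ≤ 3 * n →
      BandReach T (5 * n) (s, i) (s, i + k * (j - i)) := by
    intro k
    induction k with
    | zero => intro _; simpa using BandReach.refl (T := T) (b := 5 * n) (s, i)
    | succ k ih =>
      intro hk
      push_cast at hk
      have h₀ : (0 : ℤ) ≤ k * (j - i) := mul_nonneg (by omega) (by omega)
      refine (ih (by linarith)).trans ?_
      have h₁ := (hss.shift h₀).mono (b' := 5 * n) (by linarith)
      have e : i + ((k + 1 : ℕ) : ℤ) * (j - i) = j + k * (j - i) := by push_cast; ring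
      rwa [e]
  -- The loop gains at most `n` per turn, so it cannot jump over these `n` consecutive heights. The
  -- crossing of at most `n` steps then stays between `n + 1` and `4n`.
  obtain ⟨k, hk₁, hk₂⟩ : ∃ k : ℕ, 2 * n + 1 ≤ i + k * (j - i) ∧ i + k * (j - i) ≤ 3 * n := by
    have hz : 0 < j - i := by omega
    have h₁ := Int.emod_add_mul_ediv (2 * n + (j - i) - i) (j - i)
    have h₂ := Int.emod_nonneg (2 * n + (j - i) - i) hz.ne'
    have h₃ := Int.emod_lt_of_pos (2 * n + (j - i) - i) hz
    have h₄ : 0 ≤ (2 * n + (j - i) - i) / (j - i) := Int.ediv_nonneg (by omega) hz.le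
    refine ⟨((2 * n + (j - i) - i) / (j - i)).toNat, ?_, ?_⟩ <;>
      rw [Int.toNat_of_nonneg h₄, mul_comm _ (j - i)] <;> omega
  have hus' := (hus.mono (b' := 5 * n) (by omega)).trans (hpump k hk₂)
  set v := i + k * (j - i)
  -- move to the canonical cycle
  obtain ⟨hbs, hsb⟩ := sccRep_eq_iff.1 (hb.trans hr)
  obtain ⟨l, h₀, hl, htr⟩ := exists_traj_of_sReach hsb v
  have hl' : (l.length : ℤ) ≤ n := by rw [hn]; exact_mod_cast hl
  have hmid : BandReach T (5 * n) (s, v) (base r, h₀) ∧ n + 1 ≤ h₀ ∧ h₀ ≤ 4 * n := by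
    refine ⟨htr.bandReach (by simp only; omega) fun z hz => ?_, ?_⟩
    · have := abs_le.1 (htr.abs_sub_le hT z hz)
      simp only at this
      omega
    · rcases List.eq_nil_or_concat l with rfl | ⟨l', x, rfl⟩
      · have : v = h₀ := congrArg Prod.snd htr
        omega
      · rw [List.concat_eq_append] at htr hl'
        have hx : x = (base r, h₀) := by
          rw [traj_append] at htr
          obtain ⟨y, -, -, h⟩ := htr
          exact h
        have := abs_le.1 (htr.abs_sub_le hT x (by simp))
        rw [hx] at this hl'
        simp only at this
        omega
  obtain ⟨hmid, hh₁, hh₂⟩ := hmid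
  -- pump the canonical cycle
  obtain ⟨k', hk₁', hk₂'⟩ : ∃ k' : ℕ, 4 * n - A < h₀ + k' * A ∧ h₀ + k' * A ≤ 4 * n := by
    have h₁ := Int.emod_add_mul_ediv (4 * n - h₀) A
    have h₂ := Int.emod_nonneg (4 * n - h₀) hA'.ne'
    have h₃ := Int.emod_lt_of_pos (4 * n - h₀) hA'
    have h₄ : 0 ≤ (4 * n - h₀) / A := Int.ediv_nonneg (by omega) hA'.le
    refine ⟨((4 * n - h₀) / A).toNat, ?_, ?_⟩ <;>
      rw [Int.toNat_of_nonneg h₄, mul_comm _ A] <;> omega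
  obtain ⟨l', -, hl', hz'⟩ := hcyc.iterate h₀ k'
  have hup : BandReach T (5 * n) (base r, h₀) (base r, h₀ + k' * A) := by
    refine hl'.bandReach (by simp only; omega) fun z hz => ?_
    obtain ⟨a, ha, y, hy, e⟩ := hz' z hz
    have hy' := abs_le.1 (hcyc.abs_sub_le hT y hy)
    have h₄ : (0 : ℤ) ≤ a * A := by positivity
    have h₅ : (a : ℤ) * A ≤ k' * A := mul_le_mul_of_nonneg_right (by omega) hA'.le
    simp only [sub_zero] at hy'
    have : ((cyc r).length : ℤ) ≤ n := by rw [hn]; exact_mod_cast hlen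
    omega
  have hall := (hus'.trans hmid).trans hup
  obtain ⟨lb, kb, -, hbs'⟩ := exists_traj_of_sReach hbs 0
  obtain ⟨h₂, hdvd, hret⟩ := exists_return
    (((hpump k hk₂).trans hmid).trans hup).zReach hbs'.reflTransGen (eff r) hA
  exact ⟨_, h₂, hk₁', hk₂', hall, hdvd, hret.trans hsw.zReach⟩

end Ramp


/-- By Bézout the admissible `x` include a residue class modulo `B / gcd A B`. The least member of
this class that is at least `⌈M / A⌉` satisfies both bounds, and `y * B = x * A - f ≥ M - f ≥ 0`
makes `y` nonnegative. -/
theorem exists_pump_counts {A B : ℕ} (hA : 0 < A) (hB : 0 < B) {f M : ℤ} (hf : f ≤ M)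
    (hd : (Nat.gcd A B : ℤ) ∣ f) (hM : 0 ≤ M) :
    ∃ x y : ℕ, (x : ℤ) * A - y * B = f ∧ M ≤ x * A ∧
      (x : ℤ) * A < M + A * (B / Nat.gcd A B : ℕ) := by
  obtain ⟨t, ht⟩ := hd
  have hbez := Nat.gcd_eq_gcd_ab A B
  set a := Nat.gcdA A B
  set b := Nat.gcdB A B
  have hg : 0 < Nat.gcd A B := Nat.gcd_pos_of_pos_left _ hA
  obtain ⟨A', hA'⟩ := Nat.gcd_dvd_left A B
  obtain ⟨B', hB'⟩ := Nat.gcd_dvd_right A B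
  set g := Nat.gcd A B
  have hdiv : B / g = B' := by rw [hB', Nat.mul_div_cancel_left _ hg]
  rw [hdiv]
  have hB'0 : 0 < B' := Nat.pos_of_ne_zero fun h => by rw [h] at hB'; omega
  have hB'z : (0 : ℤ) < B' := by exact_mod_cast hB'0
  have hAz : (0 : ℤ) < A := by exact_mod_cast hA
  have hBz : (0 : ℤ) < B := by exact_mod_cast hB
  have hAg : (A : ℤ) = g * A' := by exact_mod_cast hA'
  have hBg : (B : ℤ) = g * B' := by exact_mod_cast hB'
  -- `q` is `⌈M / A⌉`; the residue `ρ` below moves it up to the class of `a * t` modulo `B'`.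
  set q : ℤ := (M + A - 1) / A
  have hq₁ := Int.emod_add_mul_ediv (M + A - 1) A
  have hq₂ := Int.emod_nonneg (M + A - 1) hAz.ne'
  have hq₃ := Int.emod_lt_of_pos (M + A - 1) hAz
  have hq₀ : 0 ≤ q := Int.ediv_nonneg (by omega) hAz.le
  have hs₁ := Int.emod_add_mul_ediv (a * t - q) B'
  have hs₂ := Int.emod_nonneg (a * t - q) hB'z.ne'
  have hs₃ := Int.emod_lt_of_pos (a * t - q) hB'z
  set s := (a * t - q) / (B' : ℤ)
  set ρ := (a * t - q) % (B' : ℤ)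
  have hxA : M ≤ (q + ρ) * A := by nlinarith
  have hxA' : (q + ρ) * A < M + A * B' := by nlinarith
  have hy : (q + ρ) * A - f = (-b * t - A' * s) * B := by
    have e₁ : q + ρ = a * t - B' * s := by linarith
    rw [e₁, ht, hbez]
    have e₂ : (B' : ℤ) * A = A' * B := by rw [hAg, hBg]; ring
    linear_combination (-s) * e₂
  have hy₀ : 0 ≤ -b * t - A' * s := by
    by_contra hneg
    have : (-b * t - A' * s) * B < 0 := mul_neg_of_neg_of_pos (by omega) hBz
    linarith
  refine ⟨(q + ρ).toNat, (-b * t - A' * s).toNat, ?_⟩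
  rw [Int.toNat_of_nonneg (by omega), Int.toNat_of_nonneg hy₀]
  exact ⟨by linarith, hxA, hxA'⟩

/-! ### Jumps, their realization and their recombination. -/

section Jump

variable {Q : Type*} [Fintype Q] {T : Q → ℤ → Q → Prop}

/-- A plan for an excursion to large heights: iterate the chosen positive cycle `c`, then follow
the walk `mid`, then iterate the chosen negative cycle `d`. -/
structure Jump (P : PumpSystem T) (P' : PumpSystem (rev T)) where
  c : Q
  d : Q
  good_c : P.good c
  good_d : P'.good d
  h : ℤ
  h' : ℤ
  lt_h : 4 * (Fintype.card Q : ℤ) - P.eff c < h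
  h_le : h ≤ 4 * (Fintype.card Q : ℤ)
  lt_h' : 4 * (Fintype.card Q : ℤ) - P'.eff d < h'
  h'_le : h' ≤ 4 * (Fintype.card Q : ℤ)
  mid : List (Q × ℤ)
  e : ℤ
  traj : Traj (ZStep T) (P.base c, h) mid (P'.base d, e)
  dvd : (Nat.gcd (P.eff c) (P'.eff d) : ℤ) ∣ h' - e

variable {P : PumpSystem T} {P' : PumpSystem (rev T)}

namespace Jump

/-- The configuration in which the excursion begins. -/
def src (J : Jump P P') : Q × ℤ := (P.base J.c, J.h)

/-- The configuration in which the excursion ends. -/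
def tgt (J : Jump P P') : Q × ℤ := (P'.base J.d, J.h')

/-- The vertices of the middle part of a plan. -/
def nodes (J : Jump P P') : List (Q × ℤ) := J.src :: J.mid

/-- An upper bound on the number of steps needed to carry out a plan. -/
def cost (J : Jump P P') : ℚ :=
  P.len J.c * ((P'.eff J.d / Nat.gcd (P.eff J.c) (P'.eff J.d) : ℕ) + 1 +
      J.mid.length / P.eff J.c) + J.mid.length +
    P'.len J.d * ((P.eff J.c / Nat.gcd (P.eff J.c) (P'.eff J.d) : ℕ) + 1 +
      J.mid.length / P'.eff J.d)

theorem end_mem_nodes (J : Jump P P') : (P'.base J.d, J.e) ∈ J.nodes := by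
  have h := J.traj
  rw [nodes, src]
  rcases List.eq_nil_or_concat J.mid with hm | ⟨l, x, hm⟩
  · rw [hm] at h
    rw [← show (P.base J.c, J.h) = (P'.base J.d, J.e) from h]
    simp
  · rw [hm, List.concat_eq_append, traj_append] at h
    obtain ⟨y, -, -, h⟩ := h
    rw [hm, ← show x = (P'.base J.d, J.e) from h]
    simp

/-- The suffix of the second walk is translated to the height of `x` and glued to the prefix of the
first. Middle walks need not be positive, so only the congruence at the end has to be checked. -/
theorem exchange (J₁ J₂ : Jump P P') {x y : Q × ℤ} {p q r s : List (Q × ℤ)}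
    (e₁ : J₁.nodes = p ++ x :: q) (e₂ : J₂.nodes = r ++ y :: s) (hxy : x.1 = y.1)
    (hmod : (Nat.gcd (P.eff J₁.c) (P'.eff J₂.d) : ℤ) ∣ J₂.h' - (J₂.e + (x.2 - y.2))) :
    ∃ J : Jump P P', J.src = J₁.src ∧ J.tgt = J₂.tgt ∧ J.mid.length = p.length + s.length := by
  obtain ⟨l₁, hl₁, h₁, -⟩ := J₁.traj.split e₁
  obtain ⟨-, -, -, h₂⟩ := J₂.traj.split e₂
  have h₃ := h₂.map (shift (x.2 - y.2)) (ZStep.shift _)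
  have e₃ : shift (x.2 - y.2) y = x := Prod.ext hxy.symm (by simp [shift])
  rw [e₃] at h₃
  refine ⟨⟨J₁.c, J₂.d, J₁.good_c, J₂.good_d, J₁.h, J₂.h', J₁.lt_h, J₁.h_le, J₂.lt_h', J₂.h'_le,
    l₁ ++ s.map (shift (x.2 - y.2)), J₂.e + (x.2 - y.2), h₁.append h₃, hmod⟩, rfl, rfl, ?_⟩
  simp [hl₁]

/-- Enough turns of the first cycle keep the translated middle walk positive. The turns themselves
are positive since they start near `4n` and dip by at most `n`; the descent is an ascent in the
reversed graph read backwards. -/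
theorem exists_traj (hT : ∀ u w v, T u w v → |w| ≤ 1) (J : Jump P P') :
    ∃ l, Traj (Within (ZStep T) fun x => 1 ≤ x.2) J.src l J.tgt ∧ (l.length : ℚ) ≤ J.cost := by
  obtain ⟨c, d, hc, hd, h, h', lt_h, h_le, lt_h', h'_le, μ, e, hμ, hdvd⟩ := J
  simp only [src, tgt, cost]
  have hA := P.eff_pos c hc
  have hB := P'.eff_pos d hd
  have hAn := (P.eff_le c hc).trans (P.len_le_card hc)
  have hBn := (P'.eff_le d hd).trans (P'.len_le_card hd)
  obtain ⟨m, hm₀, hmL, hml, hme, hmd⟩ := hμ.exists_drop hT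
  simp only at hml hme hmd
  -- The lift must cover both the drop `m` of the middle walk and the missing height `h' - e`.
  obtain ⟨x, y, hxy, hMx, hxM⟩ := exists_pump_counts hA hB (le_max_right m (h' - e)) hdvd
    (hm₀.trans (le_max_left _ _))
  have hg : 0 < Nat.gcd (P.eff c) (P'.eff d) := Nat.gcd_pos_of_pos_left _ hA
  have hcross : P.eff c * (P'.eff d / Nat.gcd (P.eff c) (P'.eff d)) =
      P'.eff d * (P.eff c / Nat.gcd (P.eff c) (P'.eff d)) := by
    rw [← Nat.mul_div_assoc _ (Nat.gcd_dvd_right _ _),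
      ← Nat.mul_div_assoc _ (Nat.gcd_dvd_left _ _), mul_comm]
  set A' := P.eff c / Nat.gcd (P.eff c) (P'.eff d)
  set B' := P'.eff d / Nat.gcd (P.eff c) (P'.eff d)
  obtain ⟨l₁, hlen₁, ht₁, hz₁⟩ := P.cycle_iterate hT hc h x
  obtain ⟨l₃, hlen₃, ht₃, hz₃⟩ := P'.cycle_iterate (rev_abs_le hT) hd h' y
  have hxA₀ : (0 : ℤ) ≤ x * P.eff c := by positivity
  have hyB₀ : (0 : ℤ) ≤ y * P'.eff d := by positivity
  have hp₁ := ht₁.within (P := fun x => 1 ≤ x.2) (by simp only; omega)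
    (fun z hz => by have := (hz₁ z hz).1; omega)
  have hμ' := hμ.map (shift (x * P.eff c)) (ZStep.shift _)
  have hp₂ := hμ'.within (P := fun x => 1 ≤ x.2) (by simp only [shift]; omega) (fun z hz => by
    obtain ⟨z', hz', rfl⟩ := List.mem_map.1 hz
    have := hml z' hz'
    simp only [shift]
    omega)
  have hp₃ := ht₃.within (P := fun x => 1 ≤ x.2) (by simp only; omega)
    (fun z hz => by have := (hz₃ z hz).1; omega)
  obtain ⟨l₃', hlen₃', hp₃'⟩ := hp₃.reverse
  have hp₃'' : Traj (Within (ZStep T) fun x => 1 ≤ x.2) (P'.base d, h' + y * P'.eff d)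
      (l₃'.map id) (P'.base d, h') :=
    hp₃'.map id fun a b hab => ⟨zStep_rev.1 hab.1, hab.2.2, hab.2.1⟩
  have e₁ : shift (x * P.eff c) (P.base c, h) = (P.base c, h + x * P.eff c) := rfl
  have e₂ : shift (x * P.eff c) (P'.base d, e) = (P'.base d, h' + y * P'.eff d) := by
    simp only [shift, Prod.mk.injEq, true_and]
    omega
  rw [e₁, e₂] at hp₂
  refine ⟨_, (hp₁.append hp₂).append hp₃'', ?_⟩
  -- As `h` and `h'` lie just below `4n`, `h' - h` is less than `A` and `h - h'` less than `B`. This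
  -- costs one extra turn on each side.
  have hxb : (x : ℤ) * P.eff c ≤ P.eff c * B' + P.eff c + μ.length := by omega
  have hyb : (y : ℤ) * P'.eff d ≤ P'.eff d * A' + P'.eff d + μ.length := by
    have : (P.eff c : ℤ) * B' = P'.eff d * A' := by exact_mod_cast hcross
    omega
  have hA' : (0 : ℚ) < P.eff c := by exact_mod_cast hA
  have hB' : (0 : ℚ) < P'.eff d := by exact_mod_cast hB
  have hxq : (x : ℚ) ≤ B' + 1 + μ.length / P.eff c := by
    have h₁ : (x : ℚ) * P.eff c ≤ P.eff c * B' + P.eff c + μ.length := by exact_mod_cast hxb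
    rw [← mul_le_mul_iff_left₀ hA', add_mul, div_mul_cancel₀ _ hA'.ne']
    linarith
  have hyq : (y : ℚ) ≤ A' + 1 + μ.length / P'.eff d := by
    have h₁ : (y : ℚ) * P'.eff d ≤ P'.eff d * A' + P'.eff d + μ.length := by exact_mod_cast hyb
    rw [← mul_le_mul_iff_left₀ hB', add_mul, div_mul_cancel₀ _ hB'.ne']
    linarith
  have h₁ := mul_le_mul_of_nonneg_left hxq (Nat.cast_nonneg' (α := ℚ) (P.len c))
  have h₂ := mul_le_mul_of_nonneg_left hyq (Nat.cast_nonneg' (α := ℚ) (P'.len d))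
  simp only [List.length_append, List.length_map, hlen₁, hlen₃', hlen₃]
  push_cast
  linarith

end Jump

/-! ### Chains of jumps, minimality, and the total cost. -/

/-- The plans in a list can be carried out one after the other, where the relation `L` leads from
the end of each one to the start of the next one. -/
def Chain (L : Q × ℤ → Q × ℤ → Prop) : Q × ℤ → List (Jump P P') → Q × ℤ → Prop
  | x, [], y => L x y
  | x, J :: l, y => L x J.src ∧ Chain L J.tgt l y

theorem chain_append_cons {L : Q × ℤ → Q × ℤ → Prop} {x y : Q × ℤ} {J : Jump P P'}
    {l₁ l₂ : List (Jump P P')} :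
    Chain L x (l₁ ++ J :: l₂) y ↔ Chain L x l₁ J.src ∧ Chain L J.tgt l₂ y := by
  induction l₁ generalizing x with
  | nil => simp [Chain]
  | cons a l ih => simp [Chain, ih, and_assoc]

theorem Chain.trans {L : Q × ℤ → Q × ℤ → Prop} (hL : ∀ x y z, L x y → L y z → L x z)
    {x y z : Q × ℤ} {l₁ l₂ : List (Jump P P')} (h₁ : Chain L x l₁ y) (h₂ : Chain L y l₂ z) :
    Chain L x (l₁ ++ l₂) z := by
  induction l₁ generalizing x with
  | nil =>
    cases l₂ with
    | nil => exact hL _ _ _ h₁ h₂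
    | cons J l => exact ⟨hL _ _ _ h₁ h₂.1, h₂.2⟩
  | cons a l ih => exact ⟨h₁.1, ih h₁.2⟩

/-- The total number of vertices of the middle parts. -/
def weight (l : List (Jump P P')) : ℕ :=
  (l.map fun J => J.nodes.length).sum

theorem weight_append (l₁ l₂ : List (Jump P P')) : weight (l₁ ++ l₂) = weight l₁ + weight l₂ := by
  simp [weight]

theorem weight_cons (J : Jump P P') (l : List (Jump P P')) :
    weight (J :: l) = J.nodes.length + weight l := by
  simp [weight]

/-- One can switch from the vertex `x` of the plan `J₁` to the vertex `y` of the plan `J₂`. -/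
def Clash (J₁ J₂ : Jump P P') (x y : Q × ℤ) : Prop :=
  x.1 = y.1 ∧ (Nat.gcd (P.eff J₁.c) (P'.eff J₂.d) : ℤ) ∣ J₂.h' - (J₂.e + (x.2 - y.2))

/-- No vertex clashes with a later one. -/
def ClashFree (l : List (Jump P P')) : Prop :=
  (∀ J ∈ l, ∀ p a q b r, J.nodes = p ++ a :: q ++ b :: r → ¬ Clash J J a b) ∧
    l.Pairwise fun J₁ J₂ => ∀ x ∈ J₁.nodes, ∀ y ∈ J₂.nodes, ¬ Clash J₁ J₂ x y

/-- Take a chain of least weight. At a clash, `Jump.exchange` gives one plan with the outer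
endpoints, which replaces the two plans and everything between them, or shortens a single plan. The
clashing vertices merge, so the weight strictly drops. -/
theorem exists_clashFree {L : Q × ℤ → Q × ℤ → Prop} {x y : Q × ℤ} {l : List (Jump P P')}
    (h : Chain L x l y) : ∃ l' : List (Jump P P'), Chain L x l' y ∧ ClashFree l' := by
  classical
  have hex : ∃ k, ∃ l : List (Jump P P'), weight l = k ∧ Chain L x l y := ⟨_, l, rfl, h⟩
  obtain ⟨l, hl, hc⟩ := Nat.find_spec hex
  have hmin := fun k hk => Nat.find_min hex (m := k) hk
  rw [← hl] at hmin
  refine ⟨l, hc, ?_, ?_⟩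
  · intro J hJ p a q b r hn hcl
    obtain ⟨l₁, l₂, rfl⟩ := List.append_of_mem hJ
    have hn' : J.nodes = p ++ a :: (q ++ b :: r) := by simpa using hn
    obtain ⟨J', hs, ht, hlen⟩ := J.exchange J hn' hn hcl.1 hcl.2
    obtain ⟨h₁, h₂⟩ := chain_append_cons.1 hc
    refine hmin (weight (l₁ ++ J' :: l₂)) ?_
      ⟨_, rfl, chain_append_cons.2 ⟨hs ▸ h₁, ht ▸ h₂⟩⟩
    have e₁ := congrArg List.length hn
    simp only [List.length_append, List.length_cons] at e₁
    have e₂ : J'.nodes.length = p.length + r.length + 1 := by simp [Jump.nodes, hlen]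
    simp only [weight_append, weight_cons]
    omega
  · rw [List.pairwise_iff_forall_sublist]
    intro J₁ J₂ hsub a ha b hb hcl
    obtain ⟨l₁, l', rfl, h₁, h₂⟩ := List.cons_sublist_iff.1 hsub
    obtain ⟨m₁, m₂, rfl⟩ := List.append_of_mem h₁
    obtain ⟨m₃, m₄, rfl⟩ := List.append_of_mem (List.singleton_sublist.1 h₂)
    obtain ⟨p, q, e₁⟩ := List.append_of_mem ha
    obtain ⟨r, s, e₂⟩ := List.append_of_mem hb
    obtain ⟨J', hs, ht, hlen⟩ := J₁.exchange J₂ e₁ e₂ hcl.1 hcl.2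
    have hc₁ := (chain_append_cons.1 (show Chain L x (m₁ ++ J₁ :: (m₂ ++ (m₃ ++ J₂ :: m₄))) y by
      simpa using hc)).1
    have hc₂ := (chain_append_cons.1 (show Chain L x ((m₁ ++ J₁ :: (m₂ ++ m₃)) ++ J₂ :: m₄) y by
      simpa using hc)).2
    refine hmin (weight (m₁ ++ J' :: m₄)) ?_
      ⟨_, rfl, chain_append_cons.2 ⟨hs ▸ hc₁, ht ▸ hc₂⟩⟩
    have e₃ := congrArg List.length e₁
    have e₄ := congrArg List.length e₂
    simp only [List.length_append, List.length_cons] at e₃ e₄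
    have e₅ : J'.nodes.length = p.length + s.length + 1 := by simp [Jump.nodes, hlen]
    simp only [weight_append, weight_cons]
    omega

theorem ClashFree.sublist {l s : List (Jump P P')} (h : ClashFree l) (hs : s.Sublist l) :
    ClashFree s :=
  ⟨fun J hJ => h.1 J (hs.subset hJ), h.2.sublist hs⟩

/-- If equality of keys implies a clash, then the keys of all vertices are distinct. -/
theorem ClashFree.weight_le {K : Type*} [Fintype K] {l : List (Jump P P')} (h : ClashFree l)
    (key : Jump P P' → Q × ℤ → K)
    (hkey : ∀ J₁ ∈ l, ∀ J₂ ∈ l, ∀ x y, key J₁ x = key J₂ y → Clash J₁ J₂ x y) :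
    weight l ≤ Fintype.card K := by
  have hnd : (l.flatMap fun J => J.nodes.map (key J)).Nodup := by
    rw [List.nodup_flatMap]
    refine ⟨fun J hJ => ?_, ?_⟩
    · by_contra hn
      obtain ⟨a, b, p, q, r, hab, e⟩ := exists_split_of_not_nodup_map hn
      exact h.1 J hJ p a q b r e (hkey J hJ J hJ a b hab)
    · refine List.Pairwise.imp_of_mem ?_ h.2
      intro J₁ J₂ h₁ h₂ hc k hk₁ hk₂
      obtain ⟨x, hx, rfl⟩ := List.mem_map.1 hk₁
      obtain ⟨y, hy, hxy⟩ := List.mem_map.1 hk₂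
      exact hc x hx y hy (hkey J₁ h₁ J₂ h₂ x y hxy.symm)
  simpa [weight, List.length_flatMap] using hnd.length_le_card

/-- Whatever the down-cycle, the gcd divides the effect of `c`; so equal states and equal heights
modulo that effect already force a clash. -/
theorem ClashFree.weight_le_of_c {l : List (Jump P P')} (h : ClashFree l) {c : Q}
    (hc : P.good c) (hl : ∀ J ∈ l, J.c = c) : weight l ≤ Fintype.card Q * P.eff c := by
  have : NeZero (P.eff c) := ⟨(P.eff_pos c hc).ne'⟩
  have := h.weight_le (K := Q × ZMod (P.eff c)) (fun _ x => (x.1, (x.2 : ZMod (P.eff c)))) (by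
    intro J₁ h₁ J₂ h₂ x y hxy
    obtain ⟨e₁, e₂⟩ := Prod.mk.inj hxy
    rw [ZMod.intCast_eq_intCast_iff_dvd_sub] at e₂
    have hd := J₂.dvd
    refine ⟨e₁, ?_⟩
    rw [hl J₂ h₂] at hd
    rw [hl J₁ h₁]
    have h₃ := (Int.natCast_dvd_natCast.2 (Nat.gcd_dvd_left (P.eff c) (P'.eff J₂.d))).trans e₂
    rw [show J₂.h' - (J₂.e + (x.2 - y.2)) = J₂.h' - J₂.e + (y.2 - x.2) by ring]
    exact dvd_add hd h₃)
  simpa [ZMod.card] using this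

/-- As before, but heights are corrected by `h' - e`, that is, measured relative to the end of the
plan. The congruence then comes from the divisibility in `J₁`, whose up-cycle is the one in the
clash. -/
theorem ClashFree.weight_le_of_d {l : List (Jump P P')} (h : ClashFree l) {d : Q}
    (hd : P'.good d) (hl : ∀ J ∈ l, J.d = d) : weight l ≤ Fintype.card Q * P'.eff d := by
  have : NeZero (P'.eff d) := ⟨(P'.eff_pos d hd).ne'⟩
  have := h.weight_le (K := Q × ZMod (P'.eff d))
    (fun J x => (x.1, ((x.2 + (J.h' - J.e) : ℤ) : ZMod (P'.eff d)))) (by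
    intro J₁ h₁ J₂ h₂ x y hxy
    obtain ⟨e₁, e₂⟩ := Prod.mk.inj hxy
    rw [ZMod.intCast_eq_intCast_iff_dvd_sub] at e₂
    have hd := J₁.dvd
    refine ⟨e₁, ?_⟩
    rw [hl J₁ h₁] at hd
    rw [hl J₂ h₂]
    have h₃ := (Int.natCast_dvd_natCast.2 (Nat.gcd_dvd_right (P.eff J₁.c) (P'.eff d))).trans e₂
    rw [show J₂.h' - (J₂.e + (x.2 - y.2)) =
      J₁.h' - J₁.e + (y.2 + (J₂.h' - J₂.e) - (x.2 + (J₁.h' - J₁.e))) by ring]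
    exact dvd_add hd h₃)
  simpa [ZMod.card] using this

/-- Only end vertices are compared. They share the state `P'.base d`, and their heights are
congruent to `h'`, so two plans with the same `h'` modulo the gcd would clash. -/
theorem ClashFree.length_le_gcd {l : List (Jump P P')} (h : ClashFree l) {c d : Q}
    (hc : P.good c) (hl : ∀ J ∈ l, J.c = c ∧ J.d = d) :
    l.length ≤ Nat.gcd (P.eff c) (P'.eff d) := by
  set g := Nat.gcd (P.eff c) (P'.eff d)
  have : NeZero g := ⟨(Nat.gcd_pos_of_pos_left _ (P.eff_pos c hc)).ne'⟩
  have hnd : (l.map fun J => (J.h' : ZMod g)).Nodup := by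
    rw [List.Nodup, List.pairwise_map]
    refine List.Pairwise.imp_of_mem ?_ h.2
    intro J₁ J₂ h₁ h₂ hcl heq
    rw [ZMod.intCast_eq_intCast_iff_dvd_sub] at heq
    refine hcl _ J₁.end_mem_nodes _ J₂.end_mem_nodes ⟨?_, ?_⟩
    · simp only [(hl J₁ h₁).2, (hl J₂ h₂).2]
    · have hd := J₁.dvd
      rw [(hl J₁ h₁).1, (hl J₁ h₁).2] at hd
      rw [(hl J₁ h₁).1, (hl J₂ h₂).2]
      rw [show J₂.h' - (J₂.e + (J₁.e - J₂.e)) = J₁.h' - J₁.e + (J₂.h' - J₁.h') by ring]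
      exact dvd_add hd heq
  simpa [ZMod.card] using hnd.length_le_card

theorem sum_le_sum_fiber {α K : Type*} [Fintype K] [DecidableEq K] (key : α → K) (F : α → ℚ)
    (G : K → ℚ) (l : List α)
    (h : ∀ k, ((l.filter fun a => key a = k).map F).sum ≤ G k) :
    (l.map F).sum ≤ ∑ k, G k := by
  refine le_trans (le_of_eq ?_) (Finset.sum_le_sum fun k _ => h k)
  clear h
  induction l with
  | nil => simp
  | cons a l ih =>
    have : ∀ k, (((a :: l).filter fun a => key a = k).map F).sum =
        (if key a = k then F a else 0) + ((l.filter fun a => key a = k).map F).sum := by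
      intro k
      by_cases hk : key a = k <;> simp [hk]
    simp only [this, Finset.sum_add_distrib, ← ih]
    simp

theorem sum_map_le_mul {α : Type*} (F : α → ℚ) (w : α → ℕ) (K : ℚ) (l : List α)
    (h : ∀ a ∈ l, F a ≤ K * w a) : (l.map F).sum ≤ K * (l.map w).sum := by
  induction l with
  | nil => simp
  | cons a l ih =>
    have h₁ := h a (by simp)
    have h₂ := ih fun b hb => h b (by simp [hb])
    simp only [List.map_cons, List.sum_cons]
    push_cast at h₂ ⊢
    linarith

theorem ClashFree.sum_cost_le {l : List (Jump P P')} (h : ClashFree l) :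
    (l.map Jump.cost).sum ≤ 7 * (Fintype.card Q : ℚ) ^ 2 := by
  classical
  set n : ℚ := (Fintype.card Q : ℚ) with hn
  have hn₀ : 0 ≤ n := by positivity
  have hsum : ∑ r, (P.size r : ℚ) = n := by rw [hn, ← P.sum_size]; push_cast; rfl
  have hsum' : ∑ r, (P'.size r : ℚ) = n := by rw [hn, ← P'.sum_size]; push_cast; rfl
  -- The middle walks and the ascents proportional to their length: `n * (eff + len) ≤ 2n * size`
  -- for each up-cycle, `2n²` in all.
  have h₁ : (l.map fun J => (1 + P.len J.c / P.eff J.c : ℚ) * J.nodes.length).sum ≤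
      ∑ c, 2 * n * P.size c := by
    refine sum_le_sum_fiber (fun J => J.c) _ _ l fun c => ?_
    rcases (l.filter fun J => J.c = c).eq_nil_or_concat with he | ⟨l₀, J, he⟩
    · rw [he]; simp only [List.map_nil, List.sum_nil]; positivity
    have hJ : J ∈ l.filter fun J => J.c = c := by simp [he]
    have hc : P.good c := by
      have := (List.mem_filter.1 hJ).2
      rw [← of_decide_eq_true this]; exact J.good_c
    have hw := (h.sublist (List.filter_sublist (p := fun J => J.c = c))).weight_le_of_c hc
      fun J hJ => of_decide_eq_true (List.mem_filter.1 hJ).2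
    refine (sum_map_le_mul _ (fun J => J.nodes.length) (1 + P.len c / P.eff c : ℚ) _ ?_).trans ?_
    · intro J hJ
      rw [of_decide_eq_true (List.mem_filter.1 hJ).2]
    · have hA : (0 : ℚ) < P.eff c := by exact_mod_cast P.eff_pos c hc
      have hA' : (P.eff c : ℚ) ≤ P.len c := by exact_mod_cast P.eff_le c hc
      have hA'' : (P.len c : ℚ) ≤ P.size c := by exact_mod_cast P.len_le c hc
      have hw' : ((weight (l.filter fun J => J.c = c) : ℕ) : ℚ) ≤
          n * P.eff c := by rw [hn]; exact_mod_cast hw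
      refine (mul_le_mul_of_nonneg_left hw' (by positivity)).trans ?_
      have : (1 + P.len c / P.eff c : ℚ) * (n * P.eff c) = n * (P.eff c + P.len c) := by
        field_simp
      rw [this]
      nlinarith
  -- The descents proportional to the middle length: `n²` in all.
  have h₂ : (l.map fun J => (P'.len J.d / P'.eff J.d : ℚ) * J.nodes.length).sum ≤
      ∑ d, n * P'.size d := by
    refine sum_le_sum_fiber (fun J => J.d) _ _ l fun c => ?_
    rcases (l.filter fun J => J.d = c).eq_nil_or_concat with he | ⟨l₀, J, he⟩
    · rw [he]; simp only [List.map_nil, List.sum_nil]; positivity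
    have hJ : J ∈ l.filter fun J => J.d = c := by simp [he]
    have hc : P'.good c := by
      have := (List.mem_filter.1 hJ).2
      rw [← of_decide_eq_true this]; exact J.good_d
    have hw := (h.sublist (List.filter_sublist (p := fun J => J.d = c))).weight_le_of_d hc
      fun J hJ => of_decide_eq_true (List.mem_filter.1 hJ).2
    refine (sum_map_le_mul _ (fun J => J.nodes.length) (P'.len c / P'.eff c : ℚ) _ ?_).trans ?_
    · intro J hJ
      rw [of_decide_eq_true (List.mem_filter.1 hJ).2]
    · have hA : (0 : ℚ) < P'.eff c := by exact_mod_cast P'.eff_pos c hc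
      have hA'' : (P'.len c : ℚ) ≤ P'.size c := by exact_mod_cast P'.len_le c hc
      have hw' : ((weight (l.filter fun J => J.d = c) : ℕ) : ℚ) ≤
          n * P'.eff c := by rw [hn]; exact_mod_cast hw
      refine (mul_le_mul_of_nonneg_left hw' (by positivity)).trans ?_
      have : (P'.len c / P'.eff c : ℚ) * (n * P'.eff c) = n * P'.len c := by
        field_simp
      rw [this]
      nlinarith
  -- The fixed number of turns per jump. For a pair of cycles there are at most `g` jumps, and `g *
  -- (B / g + 1) = B + g ≤ 2B`, so the total is `4n²`.
  have h₃ : (l.map fun J => (P.len J.c *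
        ((P'.eff J.d / Nat.gcd (P.eff J.c) (P'.eff J.d) : ℕ) + 1) + P'.len J.d *
        ((P.eff J.c / Nat.gcd (P.eff J.c) (P'.eff J.d) : ℕ) + 1) : ℚ)).sum ≤
      ∑ k : Q × Q, 4 * ((P.size k.1 : ℚ) * P'.size k.2) := by
    refine sum_le_sum_fiber (fun J => (J.c, J.d)) _ _ l fun k => ?_
    obtain ⟨c, d⟩ := k
    rcases (l.filter fun J => (J.c, J.d) = (c, d)).eq_nil_or_concat with he | ⟨l₀, J, he⟩
    · rw [he]; simp only [List.map_nil, List.sum_nil]; positivity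
    have hJ : J ∈ l.filter fun J => (J.c, J.d) = (c, d) := by rw [he]; simp
    have hcd : ∀ J ∈ l.filter fun J => (J.c, J.d) = (c, d), J.c = c ∧ J.d = d := fun J hJ =>
      Prod.mk.inj (of_decide_eq_true (List.mem_filter.1 hJ).2)
    have hc : P.good c := by rw [← (hcd J hJ).1]; exact J.good_c
    have hd : P'.good d := by rw [← (hcd J hJ).2]; exact J.good_d
    have hw := (h.sublist
      (List.filter_sublist (p := fun J => (J.c, J.d) = (c, d)))).length_le_gcd hc hcd
    refine (sum_map_le_mul _ (fun _ => 1) (P.len c *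
        ((P'.eff d / Nat.gcd (P.eff c) (P'.eff d) : ℕ) + 1) + P'.len d *
        ((P.eff c / Nat.gcd (P.eff c) (P'.eff d) : ℕ) + 1) : ℚ) _ ?_).trans ?_
    · intro J hJ
      rw [(hcd J hJ).1, (hcd J hJ).2]
      simp
    · have hA : 0 < P.eff c := P.eff_pos c hc
      have hA' : (P.eff c : ℚ) ≤ P.len c := by exact_mod_cast P.eff_le c hc
      have hA'' : (P.len c : ℚ) ≤ P.size c := by exact_mod_cast P.len_le c hc
      have hB' : (P'.eff d : ℚ) ≤ P'.len d := by exact_mod_cast P'.eff_le d hd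
      have hB'' : (P'.len d : ℚ) ≤ P'.size d := by exact_mod_cast P'.len_le d hd
      have hB : 0 < P'.eff d := P'.eff_pos d hd
      have hgA : (Nat.gcd (P.eff c) (P'.eff d) : ℚ) ≤ P.eff c := by
        exact_mod_cast Nat.gcd_le_left _ hA
      have hgB : (Nat.gcd (P.eff c) (P'.eff d) : ℚ) ≤ P'.eff d := by
        exact_mod_cast Nat.gcd_le_right _ hB
      have eA : ((P.eff c / Nat.gcd (P.eff c) (P'.eff d) : ℕ) : ℚ) *
          Nat.gcd (P.eff c) (P'.eff d) = P.eff c := by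
        exact_mod_cast Nat.div_mul_cancel (Nat.gcd_dvd_left (P.eff c) (P'.eff d))
      have eB : ((P'.eff d / Nat.gcd (P.eff c) (P'.eff d) : ℕ) : ℚ) *
          Nat.gcd (P.eff c) (P'.eff d) = P'.eff d := by
        exact_mod_cast Nat.div_mul_cancel (Nat.gcd_dvd_right (P.eff c) (P'.eff d))
      set g := Nat.gcd (P.eff c) (P'.eff d)
      have hw' : (((l.filter fun J => (J.c, J.d) = (c, d)).map fun _ => 1).sum : ℕ) ≤ (g : ℚ) := by
        simpa using hw
      refine (mul_le_mul_of_nonneg_left hw' (by positivity)).trans ?_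
      have e : (P.len c * ((P'.eff d / g : ℕ) + 1) + P'.len d * ((P.eff c / g : ℕ) + 1) : ℚ) * g =
          P.len c * (P'.eff d + g) + P'.len d * (P.eff c + g) := by
        linear_combination (P.len c : ℚ) * eB + (P'.len d : ℚ) * eA
      rw [e]
      have i₁ : (P.len c : ℚ) * (P'.eff d + g) ≤ P.size c * (2 * P'.size d) :=
        mul_le_mul hA'' (by linarith) (by positivity) (by positivity)
      have i₂ : (P'.len d : ℚ) * (P.eff c + g) ≤ P'.size d * (2 * P.size c) :=
        mul_le_mul hB'' (by linarith) (by positivity) (by positivity)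
      dsimp only
      linarith
  rw [← Finset.mul_sum, hsum] at h₁
  rw [← Finset.mul_sum, hsum'] at h₂
  rw [← Finset.mul_sum, Fintype.sum_prod_type] at h₃
  simp only [← Finset.mul_sum, hsum', ← Finset.sum_mul, hsum] at h₃
  have h₄ : (l.map Jump.cost).sum ≤
      (l.map fun J => (1 + P.len J.c / P.eff J.c : ℚ) * J.nodes.length).sum +
      (l.map fun J => (P'.len J.d / P'.eff J.d : ℚ) * J.nodes.length).sum +
      (l.map fun J => (P.len J.c *
        ((P'.eff J.d / Nat.gcd (P.eff J.c) (P'.eff J.d) : ℕ) + 1) + P'.len J.d *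
        ((P.eff J.c / Nat.gcd (P.eff J.c) (P'.eff J.d) : ℕ) + 1) : ℚ)).sum := by
    rw [← List.sum_map_add, ← List.sum_map_add]
    refine List.sum_le_sum fun J _ => ?_
    have hx : (0 : ℚ) ≤ P.len J.c / P.eff J.c := by positivity
    have hy : (0 : ℚ) ≤ P'.len J.d / P'.eff J.d := by positivity
    rw [Jump.cost, Jump.nodes, List.length_cons]
    push_cast
    have e₁ : (P.len J.c : ℚ) * (J.mid.length / P.eff J.c) =
      P.len J.c / P.eff J.c * J.mid.length := by ring
    have e₂ : (P'.len J.d : ℚ) * (J.mid.length / P'.eff J.d) =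
      P'.len J.d / P'.eff J.d * J.mid.length := by ring
    linarith
  nlinarith

end Jump


/-! ### From runs of the one-counter system to chains of jumps and back. -/

theorem Traj.of_within {V : Type*} {R : V → V → Prop} {P : V → Prop} {x y : V} {l : List V}
    (h : Traj (Within R P) x l y) : Traj R x l y ∧ ∀ z ∈ l, P z := by
  induction l generalizing x with
  | nil => exact ⟨h, by simp⟩
  | cons a l ih =>
    obtain ⟨h₁, h₂⟩ := ih h.2
    exact ⟨⟨h.1.1, h₁⟩, by simpa using ⟨h.1.2.2, h₂⟩⟩

theorem PosReach.bandReach_or {Q : Type*} {T : Q → ℤ → Q → Prop} (b : ℤ) {x y : Q × ℤ}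
    (h : PosReach T x y) (hx : x.2 ≤ b) :
    BandReach T b x y ∨ ∃ z, b < z.2 ∧ PosReach T x z ∧ PosReach T z y := by
  induction h using ReflTransGen.head_induction_on with
  | refl => exact Or.inl ReflTransGen.refl
  | head hac hcb ih =>
    rename_i a c
    rcases lt_or_ge b c.2 with hc | hc
    · exact Or.inr ⟨c, hc, ReflTransGen.single hac, hcb⟩
    · rcases ih hc with ih | ⟨z, hz, h₁, h₂⟩
      · exact Or.inl (ReflTransGen.head ⟨hac.1, ⟨hac.2.1, hx⟩, ⟨hac.2.2, hc⟩⟩ ih)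
      · exact Or.inr ⟨z, hz, ReflTransGen.head hac h₁, h₂⟩

section System

variable {Q : Type*} (O : OneCounterSystem Q)

/-- The weighted graph of the non-zero transitions. -/
def posGraph (u : Q) (w : ℤ) (v : Q) : Prop :=
  (u, w, v) ∈ O.nonzeroTransitions

theorem posGraph_abs_le (u : Q) (w : ℤ) (v : Q) (h : posGraph O u w v) : |w| ≤ 1 := by
  have := O.effect_nonzero _ h
  simp only [Set.mem_insert_iff, Set.mem_singleton_iff] at this
  rcases this with rfl | rfl | rfl <;> simp

/-- The configuration with the given state and counter value. -/
def toConf (x : Q × ℤ) : Q × ℕ := (x.1, x.2.toNat)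

variable {O}

theorem step_of_within {x y : Q × ℤ} (h : Within (ZStep (posGraph O)) (fun x => 1 ≤ x.2) x y) :
    O.Step (toConf x) (toConf y) := by
  obtain ⟨h₁, h₂, h₃⟩ := h
  refine ⟨_, Or.inl ⟨h₁, ?_⟩, rfl, rfl, ?_⟩ <;> simp only [toConf] <;> omega

variable (O) in
/-- Reachability of `O` through heights at most `b`. -/
def LowReach (b : ℕ) (x y : Q × ℤ) : Prop :=
  ReflTransGen (Within O.Step fun x => x.2 ≤ b) (toConf x) (toConf y)

theorem BandReach.lowReach {b : ℕ} {x y : Q × ℤ} (h : BandReach (posGraph O) b x y) :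
    LowReach O b x y := by
  refine ReflTransGen.lift toConf (fun a c hac => ⟨step_of_within ⟨hac.1, hac.2.1.1, hac.2.2.1⟩,
    ?_, ?_⟩) _ _ h <;> have := hac.2 <;> simp only [toConf] <;> omega

theorem LowReach.trans {b : ℕ} {x y z : Q × ℤ} (h : LowReach O b x y) (h' : LowReach O b y z) :
    LowReach O b x z :=
  ReflTransGen.trans h h'

theorem Traj.exists_isPath {x y : Q × ℕ} {l : List (Q × ℕ)} (h : Traj O.Step x l y) :
    ∃ ρ : List ((Q × ℕ) × (Q × ℤ × Q)), O.IsPath x ρ y ∧ ρ.length = l.length := by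
  induction l generalizing x with
  | nil => exact ⟨[], h, rfl⟩
  | cons a l ih =>
    obtain ⟨⟨t, ht⟩, h⟩ := h
    obtain ⟨ρ, hρ, hlen⟩ := ih h
    exact ⟨(x, t) :: ρ, ⟨rfl, a, ht, hρ⟩, by simp [hlen]⟩

variable [Fintype Q]

/-- A single jump replaces the whole excursion, however often it crosses `5n`: the ramps of the
graph and of its reversal meet at one high configuration. The heights `k`, `k'` differ from `h`,
`h'` by multiples of the two effects, hence of their gcd. -/
theorem exists_chain_of_posReach (P : PumpSystem (posGraph O)) (P' : PumpSystem (rev (posGraph O)))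
    {u v : Q} (h : PosReach (posGraph O) (u, 1) (v, 1)) :
    ∃ l : List (Jump P P'), Chain (LowReach O (5 * Fintype.card Q)) (u, 1) l (v, 1) := by
  have hn : 0 < Fintype.card Q := Fintype.card_pos_iff.2 ⟨u⟩
  rcases h.bandReach_or (5 * Fintype.card Q) (by simp only; omega) with h | ⟨⟨w, m⟩, hm, h₁, h₂⟩
  · exact ⟨[], BandReach.lowReach (by exact_mod_cast h)⟩
  · simp only at hm
    obtain ⟨c, hc, h, k, lo, hi, hr, hk, hw⟩ := P.ramp u w m (by omega) h₁
    obtain ⟨d, hd, h', k', lo', hi', hr', hk', hw'⟩ := P'.ramp v w m (by omega) (posReach_rev h₂)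
    have hz := reflTransGen_shift (hw.trans (zReach_of_rev hw')) (h - k)
    rw [add_sub_cancel] at hz
    obtain ⟨μ, hμ⟩ := exists_traj hz
    refine ⟨[⟨c, d, hc, hd, h, h', lo, hi, lo', hi', μ, _, hμ, ?_⟩],
      BandReach.lowReach (by exact_mod_cast hr),
      BandReach.lowReach (by exact_mod_cast bandReach_of_rev hr')⟩
    have i₁ := (Int.natCast_dvd_natCast.2 (Nat.gcd_dvd_left (P.eff c) (P'.eff d))).trans hk
    have i₂ := (Int.natCast_dvd_natCast.2 (Nat.gcd_dvd_right (P.eff c) (P'.eff d))).trans hk'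
    rw [show h' - (k' + (h - k)) = (k - h) - (k' - h') by ring]
    exact dvd_sub i₁ i₂

theorem exists_chain (P : PumpSystem (posGraph O)) (P' : PumpSystem (rev (posGraph O)))
    {p q : Q} (h : O.Reachable (p, 0) (q, 0)) :
    ∃ l : List (Jump P P'), Chain (LowReach O (5 * Fintype.card Q)) (p, 0) l (q, 0) := by
  have hn : 0 < Fintype.card Q := Fintype.card_pos_iff.2 ⟨p⟩
  have htrans : ∀ x y z, LowReach O (5 * Fintype.card Q) x y →
      LowReach O (5 * Fintype.card Q) y z → LowReach O (5 * Fintype.card Q) x z :=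
    fun _ _ _ h h' => h.trans h'
  -- Induction along the run: at a positive height, the invariant keeps the current excursion
  -- unprocessed from its start `(u, 1)`, and converts it only on the return to zero.
  suffices ∀ y, ReflTransGen O.Step (p, 0) y →
      (y.2 = 0 ∧ ∃ l : List (Jump P P'), Chain (LowReach O (5 * Fintype.card Q)) (p, 0) l (y.1, 0)) ∨
      (1 ≤ y.2 ∧ ∃ u, PosReach (posGraph O) (u, 1) (y.1, (y.2 : ℤ)) ∧
        ∃ l : List (Jump P P'), Chain (LowReach O (5 * Fintype.card Q)) (p, 0) l (u, 1)) by
    rcases this _ h with h | h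
    · exact h.2
    · exact absurd h.1 (by simp)
  intro y hy
  induction hy with
  | refl => exact Or.inl ⟨rfl, [], ReflTransGen.refl⟩
  | tail hpa hab ih =>
    rename_i a b
    have hab' := hab
    obtain ⟨⟨s, w, t⟩, hfire, hs, ht, hw⟩ := hab'
    simp only at hs ht hw
    rcases ih with ⟨ha, l, hl⟩ | ⟨ha, u, hu, l, hl⟩
    · have hz : (s, w, t) ∈ O.zeroTests := by
        rcases hfire with hf | hf
        · omega
        · exact hf.1
      have hw' := O.effect_zero _ hz
      simp only [Set.mem_insert_iff, Set.mem_singleton_iff] at hw'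
      have hlow : LowReach O (5 * Fintype.card Q) (a.1, 0) (b.1, (b.2 : ℤ)) := by
        refine ReflTransGen.single ⟨?_, ?_, ?_⟩
        · have e₁ : toConf (a.1, (0 : ℤ)) = a := Prod.ext rfl (by simp [toConf, ha])
          have e₂ : toConf (b.1, (b.2 : ℤ)) = b := Prod.ext rfl (by simp [toConf])
          rwa [e₁, e₂]
        · simp [toConf]
        · simp only [toConf]; omega
      have hch := hl.trans htrans (l₂ := []) hlow
      rcases Nat.eq_zero_or_pos b.2 with hb | hb
      · rw [hb] at hch
        exact Or.inl ⟨hb, _, hch⟩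
      · have hb1 : b.2 = 1 := by omega
        rw [hb1] at hch ⊢
        exact Or.inr ⟨le_rfl, b.1, ReflTransGen.refl, _, hch⟩
    · have hz : (s, w, t) ∈ O.nonzeroTransitions := by
        rcases hfire with hf | hf
        · exact hf.1
        · omega
      have hw' := abs_le.1 (posGraph_abs_le O s w t hz)
      rcases Nat.eq_zero_or_pos b.2 with hb | hb
      · have ha1 : a.2 = 1 := by omega
        rw [ha1] at hu
        obtain ⟨l', hl'⟩ := exists_chain_of_posReach P P' hu
        have hlow : LowReach O (5 * Fintype.card Q) (a.1, 1) (b.1, 0) := by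
          refine ReflTransGen.single ⟨?_, ?_, ?_⟩
          · have e₁ : toConf (a.1, (1 : ℤ)) = a := Prod.ext rfl (by simp [toConf, ha1])
            have e₂ : toConf (b.1, (0 : ℤ)) = b := Prod.ext rfl (by simp [toConf, hb])
            rwa [e₁, e₂]
          · simp only [toConf]; omega
          · simp [toConf]
        exact Or.inl ⟨hb, _, (hl.trans htrans hl').trans htrans (l₂ := []) hlow⟩
      · refine Or.inr ⟨hb, u, ReflTransGen.tail hu ⟨?_, ?_, ?_⟩, l, hl⟩
        · have e : (b.2 : ℤ) - a.2 = w := by omega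
          simp only [ZStep, e, hs, ht]
          exact hz
        · simp only; omega
        · simp only; omega

open Classical in
-- The links stay inside `F` and count nothing; every step of a jump is counted, even where it is
-- low.
theorem Chain.exists_traj {P : PumpSystem (posGraph O)} {P' : PumpSystem (rev (posGraph O))}
    {F : Finset (Q × ℕ)} {b : ℕ} (hF : ∀ x : Q × ℕ, x.2 ≤ b → x ∈ F) {x y : Q × ℤ}
    {l : List (Jump P P')} (h : Chain (LowReach O b) x l y) :
    ∃ w, Traj O.Step (toConf x) w (toConf y) ∧
      (w.countP (· ∉ F) : ℚ) ≤ (l.map Jump.cost).sum := by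
  have hlow : ∀ {x y}, LowReach O b x y →
      ∃ w, Traj O.Step (toConf x) w (toConf y) ∧ w.countP (· ∉ F) = 0 := by
    intro x y h
    obtain ⟨w, hw⟩ := CounterWalk.exists_traj h
    refine ⟨w, hw.of_within.1, ?_⟩
    rw [List.countP_eq_zero]
    intro z hz
    simpa using hF z (hw.of_within.2 z hz)
  induction l generalizing x with
  | nil =>
    obtain ⟨w, hw, hc⟩ := hlow h
    exact ⟨w, hw, by rw [hc]; simp⟩
  | cons J l ih =>
    obtain ⟨w₁, h₁, hc₁⟩ := hlow h.1
    obtain ⟨w₂, h₂, hc₂⟩ := J.exists_traj (posGraph_abs_le O)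
    obtain ⟨w₃, h₃, hc₃⟩ := ih h.2
    refine ⟨_, (h₁.append (h₂.map toConf fun _ _ => step_of_within)).append h₃, ?_⟩
    have hle : (((w₂.map toConf).countP (· ∉ F) : ℕ) : ℚ) ≤ w₂.length := by
      have := List.countP_le_length (p := (· ∉ F)) (l := w₂.map toConf)
      rw [List.length_map] at this
      exact_mod_cast this
    simp only [List.countP_append, List.map_cons, List.sum_cons, hc₁]
    push_cast
    linarith

end System

end CounterWalk

theorem theorem1 {Q : Type*} [Fintype Q] (O : OneCounterSystem Q) (n : ℕ)
    (hn : Fintype.card Q = n) (pα pβ : Q) (h : O.Reachable (pα, 0) (pβ, 0)) :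
    ∃ ρ : List ((Q × ℕ) × (Q × ℤ × Q)),
      O.IsPath (pα, 0) ρ (pβ, 0) ∧ ρ.length ≤ 14 * n ^ 2 := by
  classical
  subst hn
  set n := Fintype.card Q
  have hn : 0 < n := Fintype.card_pos_iff.2 ⟨pα⟩
  obtain ⟨P⟩ := CounterWalk.nonempty_pumpSystem (CounterWalk.posGraph_abs_le O)
  obtain ⟨P'⟩ := CounterWalk.nonempty_pumpSystem
    (CounterWalk.rev_abs_le (CounterWalk.posGraph_abs_le O))
  obtain ⟨l, hl⟩ := CounterWalk.exists_chain P P' h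
  obtain ⟨l, hl, hfree⟩ := CounterWalk.exists_clashFree hl
  let F : Finset (Q × ℕ) := Finset.univ ×ˢ Finset.range (5 * n + 1)
  have hF : ∀ x : Q × ℕ, x.2 ≤ 5 * n → x ∈ F := fun x hx => by
    simp only [F, Finset.mem_product, Finset.mem_univ, Finset.mem_range, true_and]
    omega
  obtain ⟨w, hw, hc⟩ := hl.exists_traj hF
  obtain ⟨w', hw', hlen⟩ := hw.exists_length_le F
  obtain ⟨ρ, hρ, hρlen⟩ := hw'.exists_isPath
  refine ⟨ρ, hρ, ?_⟩
  have hcount : w.countP (· ∉ F) ≤ 7 * n ^ 2 := by exact_mod_cast hc.trans hfree.sum_cost_le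
  have hcard : F.card = n * (5 * n + 1) := by simp [F, n]
  rw [hρlen]
  rw [hcard] at hlen
  have hlen' : w'.length ≤ n * (5 * n + 1) + 7 * n ^ 2 :=
    hlen.trans (Nat.add_le_add_left (by convert hcount) _)
  -- The total is `12n² + n`, within the claimed bound.
  have hsq : n ≤ n ^ 2 := Nat.le_self_pow two_ne_zero n
  linarith [show n * (5 * n + 1) = 5 * n ^ 2 + n by ring]
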